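/- For an integer $n$ let $K_n\subset\mathbb C$ be the splitting field over $\mathbb Q$ of $f_n(x)=x^4-nx^3-6x^2+nx+1$, and let $k_n=\mathbb Q(\sqrt{n^2+16})$ (for $n\ne 0,\pm3$ the quadratic subfield of $K_n$). **Theorem.** Let $n\equiv 2\pmod 4$ be a positive integer. Write $n^2+16=y^2d$ with $d$ squarefree and $y$ a positive integer, and assume that $$\epsilon=\frac{n+y\sqrt d}{4}$$ is the fundamental unit of $k_n$, that is, the unit $\epsilon>1$ of the ring of integers of $k_n$ such that every unit is $\pm\epsilon^j$ for some $j\in\mathbb Z$. Let $\bar\epsilon=(n-y\sqrt d)/4$ be its Galois conjugate and, for $j\ge 0$, define the integers $$u_j=\frac{\epsilon^j-\bar\epsilon^j}{\epsilon-\bar\epsilon},\qquad v_j=\epsilon^j+\bar\epsilon^j .$$ Let $r_0$ be the smallest odd positive index $r$ for which $d\mid u_r$, and suppose that there is a prime $p\equiv 1\pmod 4$ dividing $v_{r_0}$ such that $d\,u_{r_0}$ is a quadratic nonresidue mod $p$. Then there is no positive integer $m\ne n$ with $K_m=K_n$. Moreover, all these hypotheses hold for $n=6$ with $r_0=13$,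 $p=53$; for $n=10$ with $r_0=29$, $p=64233493$; and for $n=14$ with $r_0=53$, $p=408359633417260832077$. Consequently, for each $n\in\{6,10,14\}$ there is no positive integer $m\ne n$ with $K_m=K_n$. -/

import Mathlib

open Polynomial

noncomputable section

/-- The simplest quartic polynomial `f_n(x) = x⁴ - n x³ - 6 x² + n x + 1`, over `ℚ`. -/
def simplestQuartic (n : ℤ) : ℚ[X] :=
  X ^ 4 - C (n : ℚ) * X ^ 3 - 6 * X ^ 2 + C (n : ℚ) * X + 1

/-- The field `K_n`: the splitting field of `f_n` over `ℚ`, realised as a subfield of `ℂ`. -/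
def simplestQuarticField (n : ℤ) : IntermediateField ℚ ℂ :=
  IntermediateField.adjoin ℚ ((simplestQuartic n).rootSet ℂ)

/-- The field `k_n = ℚ(√(n² + 16))`, realised as a subfield of `ℝ`. -/
def quadraticField (n : ℤ) : IntermediateField ℚ ℝ :=
  IntermediateField.adjoin ℚ {Real.sqrt ((n : ℝ) ^ 2 + 16)}

/-- The real number `ε` is the fundamental unit of the subfield `k` of `ℝ` (meant for real
quadratic `k`): it is a unit of the ring of integers of `k`, it is larger than `1`, and each unit
is, up to sign, an integral power of it. -/
def IsFundamentalUnit (k : IntermediateField ℚ ℝ) (ε : ℝ) : Prop :=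
  1 < ε ∧ ∃ w : (NumberField.RingOfIntegers k)ˣ,
    (((w : NumberField.RingOfIntegers k) : k) : ℝ) = ε ∧
      ∀ η : (NumberField.RingOfIntegers k)ˣ, ∃ j : ℤ, η = w ^ j ∨ η = -w ^ j

/-- The hypotheses of the uniqueness criterion, for the index `n`, the odd index `r₀` and the
prime `p`. Here `ε` is the fundamental unit, `ε'` is its Galois conjugate, and the sequences of
integers `u`, `v` are `u_j = (ε ^ j - ε' ^ j) / (ε - ε')` and `v_j = ε ^ j + ε' ^ j`. -/
def UniquenessCriterion (n : ℤ) (r₀ p : ℕ) : Prop :=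
  ∃ (d y : ℕ) (ε ε' : ℝ) (u v : ℕ → ℤ),
    Squarefree d ∧ n ^ 2 + 16 = (y : ℤ) ^ 2 * (d : ℤ) ∧
    ε = ((n : ℝ) + (y : ℝ) * Real.sqrt (d : ℝ)) / 4 ∧
    ε' = ((n : ℝ) - (y : ℝ) * Real.sqrt (d : ℝ)) / 4 ∧
    IsFundamentalUnit (quadraticField n) ε ∧
    (∀ j : ℕ, (u j : ℝ) = (ε ^ j - ε' ^ j) / (ε - ε')) ∧
    (∀ j : ℕ, (v j : ℝ) = ε ^ j + ε' ^ j) ∧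
    IsLeast {r : ℕ | Odd r ∧ (d : ℤ) ∣ u r} r₀ ∧
    p.Prime ∧ p % 4 = 1 ∧ (p : ℤ) ∣ v r₀ ∧
    ¬ IsSquare (((d : ℤ) * u r₀ : ℤ) : ZMod p)

end

/-! Let `w = √(n²+16)` and `ε = (n+w)/4`. Over `k_n` the quartic splits as `(x² - 2εx - 1)(x² - 2ε̄x
- 1)`, so `K_n = k_n(α)` with `α² = ε² + 1 = εw/2`. The norm of `ε² + 1` is `(n²+16)/4`, not a
rational square, so `α ∉ k_n`.

If `K_m = K_n`, Kummer theory gives `√(m²+16) = cw` with `c` rational, and the two radicands `ε² +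
1` and `η² + 1`, with `η = (m+cw)/4`, differ by a square of `k_n`
(`exists_of_simplestQuarticField_eq`). Since `n ≡ 2 mod 4` forces `m` to be even, `η` is a unit of
norm `-1`, so `η = ε^j` with `j` odd, and comparing coefficients gives `c = u_j`. The ratio of the
radicands is then `ε^(j-1) u_j`; as `j - 1` is even, `u_j` is a square in `k_n`, that is, `u_j` or
`d u_j` is a perfect square.

Both are impossible for `j ≠ 1`. A Cohn-type argument gives `u_j ≡ -1` modulo some `v_{2^(s+1)} ≡ 3
mod 4` (`not_isSquare_u`). If `d u_j` is a square, then `d ∣ u_j`, so `r₀ ∣ j` and `u_j ≡ u_{r₀}`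
modulo `p`, against the nonresidue hypothesis (`not_isSquare_mul_u`). Finally `j = 1` means `m = n`.
-/

/-- Integer sequences given by Binet's formulas for the roots `a`, `b` of `x² - P x - 1`. -/
structure IsLucasPair (P : ℤ) (a b : ℝ) (u v : ℕ → ℤ) : Prop where
  add_eq : a + b = P
  mul_eq : a * b = -1
  sub_ne : a - b ≠ 0
  u_eq : ∀ j, (u j : ℝ) = (a ^ j - b ^ j) / (a - b)
  v_eq : ∀ j, (v j : ℝ) = a ^ j + b ^ j

/-! ### Lucas sequences: congruences and squares -/

namespace IsLucasPair

variable {P : ℤ} {a b : ℝ} {u v : ℕ → ℤ}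

theorem u_mul (h : IsLucasPair P a b u v) (j : ℕ) : (u j : ℝ) * (a - b) = a ^ j - b ^ j := by
  rw [h.u_eq, div_mul_cancel₀ _ h.sub_ne]

theorem u_one (h : IsLucasPair P a b u v) : u 1 = 1 := by
  have := h.u_eq 1
  rw [pow_one, pow_one, div_self h.sub_ne] at this
  exact_mod_cast this

theorem v_one (h : IsLucasPair P a b u v) : v 1 = P := by
  have := h.v_eq 1
  rw [pow_one, pow_one, h.add_eq] at this
  exact_mod_cast this

theorem mul_pow_eq (h : IsLucasPair P a b u v) (k : ℕ) : a ^ k * b ^ k = (-1) ^ k := by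
  rw [← mul_pow, h.mul_eq]

/-- Modulo `v k`, a shift of the index by `2k` multiplies `u` by `-(-1)^k`; this is the source of
both congruence arguments. -/
theorem u_add_two_mul (h : IsLucasPair P a b u v) (i k : ℕ) :
    u (i + 2 * k) = u (i + k) * v k - (-1) ^ k * u i := by
  have key : (u (i + 2 * k) : ℝ) = u (i + k) * v k - (-1) ^ k * u i := by
    apply mul_right_cancel₀ h.sub_ne
    rw [sub_mul, mul_right_comm, mul_assoc ((-1 : ℝ) ^ k), h.u_mul, h.u_mul, h.u_mul, h.v_eq,
      ← h.mul_pow_eq]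
    ring
  exact_mod_cast key

theorem u_add_two_mul' (h : IsLucasPair P a b u v) (i k : ℕ) :
    u (i + 2 * k) = u k * v (i + k) + (-1) ^ k * u i := by
  have key : (u (i + 2 * k) : ℝ) = u k * v (i + k) + (-1) ^ k * u i := by
    apply mul_right_cancel₀ h.sub_ne
    rw [add_mul, mul_right_comm, mul_assoc ((-1 : ℝ) ^ k), h.u_mul, h.u_mul, h.u_mul, h.v_eq,
      ← h.mul_pow_eq]
    ring
  exact_mod_cast key

theorem u_two_mul_add_one (h : IsLucasPair P a b u v) (k : ℕ) :
    u (2 * k + 1) = u k * v (k + 1) + (-1) ^ k := by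
  have := h.u_add_two_mul' 1 k
  rw [h.u_one, mul_one, add_comm 1, add_comm 1] at this
  exact this

theorem v_two_mul (h : IsLucasPair P a b u v) (k : ℕ) :
    v (2 * k) = v k ^ 2 - 2 * (-1) ^ k := by
  have key : (v (2 * k) : ℝ) = v k ^ 2 - 2 * (-1) ^ k := by
    rw [h.v_eq, h.v_eq, ← h.mul_pow_eq]
    ring
  exact_mod_cast key

theorem v_sq (h : IsLucasPair P a b u v) (k : ℕ) :
    (v k : ℝ) ^ 2 = (u k : ℝ) ^ 2 * (a - b) ^ 2 + 4 * (-1) ^ k := by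
  rw [← mul_pow, h.u_mul, h.v_eq, ← h.mul_pow_eq]
  ring

theorem two_mul_pow (h : IsLucasPair P a b u v) (k : ℕ) :
    2 * a ^ k = v k + u k * (a - b) := by
  rw [h.u_mul, h.v_eq]
  ring

/-- `v 2 = P² + 2 ≡ 3 mod 4` for odd `P`, and each further doubling is `x ↦ x² - 2`, which keeps the
class `3`. -/
theorem v_two_pow_emod (h : IsLucasPair P a b u v) (hP : Odd P) (s : ℕ) :
    v (2 ^ (s + 1)) % 4 = 3 := by
  induction s with
  | zero =>
    have := h.v_two_mul 1
    rw [h.v_one] at this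
    obtain ⟨t, rfl⟩ := hP
    norm_num at this ⊢
    rw [this]
    ring_nf
    omega
  | succ s ih =>
    have h2 := h.v_two_mul (2 ^ (s + 1))
    have he : Even (2 ^ (s + 1)) := (even_two).pow_of_ne_zero (by omega)
    rw [he.neg_one_pow] at h2
    rw [pow_succ, mul_comm, h2]
    obtain ⟨q, hq⟩ : ∃ q, v (2 ^ (s + 1)) = 4 * q + 3 := ⟨v (2 ^ (s + 1)) / 4, by omega⟩
    rw [hq]
    ring_nf
    omega

theorem v_two_pow_pos (h : IsLucasPair P a b u v) (s : ℕ) : 0 < v (2 ^ (s + 1)) := by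
  have key : (0 : ℝ) < v (2 ^ (s + 1)) := by
    have ha : a ≠ 0 := by
      rintro rfl
      simpa using h.mul_eq
    rw [h.v_eq]
    have he : Even (2 ^ (s + 1)) := (even_two).pow_of_ne_zero (by omega)
    have := he.pow_nonneg b
    have := he.pow_pos ha
    linarith
  exact_mod_cast key

/-- Modulo `v k` with `k` even, a shift by an odd multiple of `2 k` is a sign change. -/
theorem dvd_u_add_of_even (h : IsLucasPair P a b u v) {k : ℕ} (hk : Even k) (i t : ℕ) :
    v k ∣ u (i + 2 * k * (2 * t + 1)) + u i := by
  induction t with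
  | zero =>
    have := h.u_add_two_mul i k
    rw [hk.neg_one_pow] at this
    exact ⟨u (i + k), by rw [mul_zero, zero_add, mul_one, this]; ring⟩
  | succ t ih =>
    have h1 := h.u_add_two_mul (i + 2 * k * (2 * t + 1)) k
    have h2 := h.u_add_two_mul (i + 2 * k * (2 * t + 1) + 2 * k) k
    rw [hk.neg_one_pow] at h1 h2
    have e : i + 2 * k * (2 * (t + 1) + 1) = i + 2 * k * (2 * t + 1) + 2 * k + 2 * k := by ring
    rw [e, h2, h1]
    obtain ⟨c, hc⟩ := ih
    exact ⟨u (i + 2 * k * (2 * t + 1) + 2 * k + k) - u (i + 2 * k * (2 * t + 1) + k) + c, by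
      linear_combination hc⟩

/-- For odd `r` a shift by `2r` preserves `u` modulo `v r`. This transports the quadratic character
of `d * u r` to all odd multiples of `r`. -/
theorem dvd_u_mul_sub_of_odd (h : IsLucasPair P a b u v) {r : ℕ} (hr : Odd r) (t : ℕ) :
    v r ∣ u (r * (2 * t + 1)) - u r := by
  induction t with
  | zero => simp
  | succ t ih =>
    have h1 := h.u_add_two_mul (r * (2 * t + 1)) r
    rw [hr.neg_one_pow] at h1
    have e : r * (2 * (t + 1) + 1) = r * (2 * t + 1) + 2 * r := by ring
    rw [e, h1]
    obtain ⟨c, hc⟩ := ih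
    exact ⟨u (r * (2 * t + 1) + r) + c, by linear_combination hc⟩

/-- Otherwise `-1` would be a square modulo `w`, while its Jacobi symbol there is `-1`. -/
theorem not_isSquare_of_dvd_add_one {x w : ℤ} (hw : w % 4 = 3) (hpos : 0 < w) (h : w ∣ x + 1) :
    ¬ IsSquare x := by
  rintro ⟨y, rfl⟩
  lift w to ℕ using hpos.le
  have h1 : IsSquare (-1 : ZMod w) := by
    refine ⟨(y : ZMod w), ?_⟩
    have := (ZMod.intCast_zmod_eq_zero_iff_dvd (y * y + 1) w).2 h
    push_cast at this
    linear_combination -this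
  refine ZMod.nonsquare_of_jacobiSym_eq_neg_one (a := -1) (b := w) ?_ (by exact_mod_cast h1)
  rw [jacobiSym.at_neg_one (Nat.odd_iff.2 (by omega)),
    ZMod.χ₄_nat_three_mod_four (by omega)]

/-- Cohn's method: write `j = 4q ± 1` with `4q = 2·2^(s+1)·(odd)`. An odd number of sign-changing
shifts from index `±1`, where `u = 1`, gives `u j ≡ -1` modulo `v (2^(s+1))`. -/
theorem not_isSquare_u (h : IsLucasPair P a b u v) (hP : Odd P) {j : ℕ} (hj : Odd j)
    (hj1 : j ≠ 1) : ¬ IsSquare (u j) := by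
  have main : ∀ q : ℕ, q ≠ 0 → ∃ s t : ℕ, 4 * q = 2 * 2 ^ (s + 1) * (2 * t + 1) := by
    intro q hq
    obtain ⟨s, t, ht, rfl⟩ := Nat.exists_eq_two_pow_mul_odd hq
    obtain ⟨t, rfl⟩ := ht
    exact ⟨s, t, by ring⟩
  have hev : ∀ s : ℕ, Even (2 ^ (s + 1)) := fun s => (even_two).pow_of_ne_zero (by omega)
  obtain hj4 | hj4 : j % 4 = 1 ∨ j % 4 = 3 := by
    have := Nat.odd_iff.1 hj
    omega
  · obtain ⟨s, t, hst⟩ := main (j / 4) (by omega)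
    have h1 := h.dvd_u_add_of_even (hev s) 1 t
    rw [← hst, h.u_one, show 1 + 4 * (j / 4) = j by omega] at h1
    exact not_isSquare_of_dvd_add_one (h.v_two_pow_emod hP s) (h.v_two_pow_pos s) h1
  -- Index `-1` is not available in `ℕ`, so the shifts start one period later, at `2k + 1 =
  -- 2·2^(s+1) - 1`, where `u` is already `-1` modulo `v (k + 1)`.
  · obtain ⟨s, t, hst⟩ := main ((j + 1) / 4) (by omega)
    obtain ⟨k, hk⟩ : ∃ k, 2 ^ (s + 1) = k + 1 := 
      Nat.exists_eq_succ_of_ne_zero (by positivity)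
    have hs := hev s
    have h0 := h.v_two_pow_emod hP s
    have hpos := h.v_two_pow_pos s
    rw [hk] at hst hs h0 hpos
    have hk' : Odd k := by
      rcases Nat.even_or_odd k with hk' | hk'
      · exact absurd hs (Nat.not_even_iff_odd.2 hk'.add_one)
      · exact hk'
    have h2 := h.u_two_mul_add_one k
    rw [hk'.neg_one_pow] at h2
    have hbase : v (k + 1) ∣ u (2 * k + 1) + 1 := ⟨u k, by rw [h2]; ring⟩
    refine not_isSquare_of_dvd_add_one h0 hpos ?_
    rcases t with _ | t
    · rw [show j = 2 * k + 1 by omega]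
      exact hbase
    · have h3 := h.dvd_u_add_of_even hs (2 * k + 1 + 2 * (k + 1)) t
      have h4 := h.u_add_two_mul (2 * k + 1) (k + 1)
      rw [hs.neg_one_pow] at h4
      have e : j = 2 * k + 1 + 2 * (k + 1) + 2 * (k + 1) * (2 * t + 1) := by
        have e1 : j + 1 = 4 * ((j + 1) / 4) := by omega
        rw [hst] at e1
        have e2 : 2 * (k + 1) * (2 * (t + 1) + 1) =
          2 * k + 1 + 2 * (k + 1) + 2 * (k + 1) * (2 * t + 1) + 1 := by ring
        omega
      rw [e]
      obtain ⟨c, hc⟩ := h3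
      obtain ⟨c', hc'⟩ := hbase
      exact ⟨c - u (2 * k + 1 + (k + 1)) + c', by linear_combination hc - h4 + hc'⟩

/-- Rank of apparition among odd indices. -/
theorem dvd_of_dvd_u (h : IsLucasPair P a b u v) {d : ℤ} {r : ℕ}
    (hr : IsLeast {r : ℕ | Odd r ∧ d ∣ u r} r) (j : ℕ) (hj : Odd j) (hd : d ∣ u j) : r ∣ j := by
  induction j using Nat.strong_induction_on with
  | _ j ih =>
    have hle : r ≤ j := hr.2 ⟨hj, hd⟩
    have hro : Odd r := hr.1.1
    have hrd : d ∣ u r := hr.1.2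
    have hr' := Nat.odd_iff.1 hro
    have hj' := Nat.odd_iff.1 hj
    rcases lt_or_ge (2 * r) j with hlt | hge
    · obtain ⟨i, rfl⟩ : ∃ i, j = i + 2 * r := ⟨j - 2 * r, by omega⟩
      have h1 := h.u_add_two_mul' i r
      rw [hro.neg_one_pow] at h1
      have h2 : d ∣ u i := by
        have := (hrd.mul_right (v (i + r))).sub hd
        rwa [h1, neg_one_mul, ← sub_eq_add_neg, sub_sub_cancel] at this
      exact (ih i (by omega) (Nat.odd_iff.2 (by omega)) h2).add (dvd_mul_left _ _)
    -- Reflecting `j = r + k` in `r` gives the odd index `i = r - k`, where `d` still divides `u`;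
    -- minimality of `r` forces `k = 0`.
    · obtain ⟨k, rfl⟩ : ∃ k, j = r + k := ⟨j - r, by omega⟩
      have hk : Even k := Nat.even_iff.2 (by omega)
      obtain ⟨i, rfl⟩ : ∃ i, r = i + k := ⟨r - k, by omega⟩
      have h1 := h.u_add_two_mul i k
      rw [hk.neg_one_pow, two_mul, ← add_assoc] at h1
      have h2 : d ∣ u i := by
        have := (hrd.mul_right (v k)).sub hd
        rwa [h1, one_mul, sub_sub_cancel] at this
      have := hr.2 ⟨Nat.odd_iff.2 (by omega), h2⟩
      have : k = 0 := by omega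
      subst this
      simp

theorem not_isSquare_mul_u (h : IsLucasPair P a b u v) {d : ℤ} (hd : Squarefree d) {r p : ℕ}
    (hr : IsLeast {r : ℕ | Odd r ∧ d ∣ u r} r) (hp : (p : ℤ) ∣ v r)
    (hsq : ¬ IsSquare ((d * u r : ℤ) : ZMod p)) {j : ℕ} (hj : Odd j) : ¬ IsSquare (d * u j) := by
  rintro ⟨e, he⟩
  have hde : d ∣ e := (hd.dvd_pow_iff_dvd two_ne_zero).1 ⟨u j, by rw [he]; ring⟩
  obtain ⟨f, rfl⟩ := hde
  have hdu : d ∣ u j := by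
    refine ⟨f * f, mul_left_cancel₀ hd.ne_zero ?_⟩
    rw [he]
    ring
  obtain ⟨s, rfl⟩ := h.dvd_of_dvd_u hr j hj hdu
  obtain ⟨t, rfl⟩ := (Nat.odd_mul.1 hj).2
  have h1 := hp.trans (h.dvd_u_mul_sub_of_odd hr.1.1 t)
  have h2 := (ZMod.intCast_zmod_eq_zero_iff_dvd _ p).2 h1
  apply hsq
  refine ⟨((d * f : ℤ) : ZMod p), ?_⟩
  rw [← Int.cast_mul, ← he]
  push_cast at h2 ⊢
  linear_combination -(d : ZMod p) * h2

end IsLucasPair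

/-! ### Quadratic extensions in coordinates -/

theorem rat_eq_zero_of_add_mul_eq_zero {E : Type*} [Field E] [CharZero E] {N : ℚ}
    (hN : ¬ IsSquare N) {w : E} (hw : w ^ 2 = N) {x y : ℚ} (h : (x : E) + y * w = 0) :
    x = 0 ∧ y = 0 := by
  have hy : y = 0 := by
    by_contra hy
    apply hN
    refine ⟨x / y, ?_⟩
    have hy' : (y : E) ≠ 0 := by exact_mod_cast hy
    have : (N : E) = ((x / y * (x / y) : ℚ) : E) := by
      push_cast
      rw [← hw, eq_neg_of_add_eq_zero_left h]
      field_simp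
    exact_mod_cast this
  subst hy
  simpa using h

theorem rat_mul_eq_zero_of_sq_eq {E : Type*} [Field E] [CharZero E] {N : ℚ}
    (hN : ¬ IsSquare N) {w : E} (hw : w ^ 2 = N) {x p q : ℚ} (h : (x : E) = (p + q * w) ^ 2) :
    x = p ^ 2 ∨ x = q ^ 2 * N := by
  have h1 := rat_eq_zero_of_add_mul_eq_zero (x := p ^ 2 + q ^ 2 * N - x) (y := 2 * p * q) hN hw
    (by push_cast; rw [h, ← hw]; ring)
  rcases mul_eq_zero.1 h1.2 with h2 | h2
  · right
    have : p = 0 := by simpa using h2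
    rw [this] at h1
    linarith [h1.1]
  · left
    rw [h2] at h1
    linarith [h1.1]

/-- Since `α² ∈ F`, the set `F + Fα` is closed under the field operations, with inverses obtained
from the conjugate `a - bα`. -/
theorem mem_adjoin_quadratic {E : Type*} [Field E] [Algebra ℚ E] (F : IntermediateField ℚ E)
    {α : E} (hα : α ^ 2 ∈ F) {S : Set E} (hS : ∀ x ∈ S, ∃ a ∈ F, ∃ b ∈ F, x = a + b * α) {x : E}
    (hx : x ∈ IntermediateField.adjoin ℚ S) : ∃ a ∈ F, ∃ b ∈ F, x = a + b * α := by
  induction hx using IntermediateField.adjoin_induction with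
  | mem x hx => exact hS x hx
  | algebraMap r => exact ⟨_, F.algebraMap_mem r, 0, F.zero_mem, by ring⟩
  | add x y _ _ hx hy =>
    obtain ⟨a, ha, b, hb, rfl⟩ := hx
    obtain ⟨c, hc, d, hd, rfl⟩ := hy
    exact ⟨a + c, add_mem ha hc, b + d, add_mem hb hd, by ring⟩
  | inv x _ hx =>
    obtain ⟨a, ha, b, hb, rfl⟩ := hx
    by_cases h0 : a + b * α = 0
    · exact ⟨0, F.zero_mem, 0, F.zero_mem, by rw [h0]; simp⟩
    -- `α` may lie in `F`, so the conjugate can vanish on a nonzero element, which then equals `2a`.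
    by_cases h1 : a - b * α = 0
    · refine ⟨(a + a)⁻¹, inv_mem (add_mem ha ha), 0, F.zero_mem, ?_⟩
      rw [← sub_eq_zero.1 h1]
      ring
    · have hn : a ^ 2 - b ^ 2 * α ^ 2 ∈ F :=
        sub_mem (pow_mem ha 2) (mul_mem (pow_mem hb 2) hα)
      refine ⟨a * (a ^ 2 - b ^ 2 * α ^ 2)⁻¹, mul_mem ha (inv_mem hn),
        -b * (a ^ 2 - b ^ 2 * α ^ 2)⁻¹, mul_mem (neg_mem hb) (inv_mem hn), ?_⟩
      have : a ^ 2 - b ^ 2 * α ^ 2 = (a + b * α) * (a - b * α) := by ring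
      rw [this]
      field_simp
      ring
  | mul x y _ _ hx hy =>
    obtain ⟨a, ha, b, hb, rfl⟩ := hx
    obtain ⟨c, hc, d, hd, rfl⟩ := hy
    exact ⟨a * c + b * d * α ^ 2, add_mem (mul_mem ha hc) (mul_mem (mul_mem hb hd) hα),
      a * d + b * c, add_mem (mul_mem ha hd) (mul_mem hb hc), by ring⟩

theorem mem_adjoin_simple_quadratic {E : Type*} [Field E] [Algebra ℚ E] {N : ℚ} {w : E}
    (hw : w ^ 2 = N) {x : E} :
    x ∈ IntermediateField.adjoin ℚ {w} ↔ ∃ p q : ℚ, x = p + q * w := by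
  constructor
  · intro hx
    obtain ⟨a, ha, b, hb, h⟩ := mem_adjoin_quadratic (⊥ : IntermediateField ℚ E) (α := w)
      (by rw [hw]; exact IntermediateField.mem_bot.2 ⟨N, by simp⟩) (S := {w})
      (by
        rintro x rfl
        exact ⟨0, zero_mem _, 1, one_mem _, by ring⟩) hx
    obtain ⟨p, rfl⟩ := IntermediateField.mem_bot.1 ha
    obtain ⟨q, rfl⟩ := IntermediateField.mem_bot.1 hb
    exact ⟨p, q, by simpa using h⟩
  · rintro ⟨p, q, rfl⟩
    have h : ∀ r : ℚ, (r : E) ∈ IntermediateField.adjoin ℚ {w} := fun r => by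
      simp
    exact add_mem (h p) (mul_mem (h q) (IntermediateField.mem_adjoin_simple_self ℚ w))

/-! ### Structure of the simplest quartic fields -/

theorem mem_rootSet_simplestQuartic {n : ℤ} {x : ℂ} :
    x ∈ (simplestQuartic n).rootSet ℂ ↔ x ^ 4 - n * x ^ 3 - 6 * x ^ 2 + n * x + 1 = 0 := by
  have h0 : simplestQuartic n ≠ 0 := by
    intro h
    have := congrArg (Polynomial.eval 0) h
    simp [simplestQuartic] at this
  have h6 : Polynomial.aeval x (6 : Polynomial ℚ) = 6 := map_ofNat _ 6
  rw [Polynomial.mem_rootSet, and_iff_right h0]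
  simp [simplestQuartic, h6]

section

variable {n : ℤ} {w α : ℂ}

theorem simplestQuartic_factor (hw : w ^ 2 = (n : ℂ) ^ 2 + 16) (x : ℂ) :
    x ^ 4 - n * x ^ 3 - 6 * x ^ 2 + n * x + 1 =
      (x ^ 2 - 2 * ((n + w) / 4) * x - 1) * (x ^ 2 - 2 * ((n - w) / 4) * x - 1) := by
  linear_combination x ^ 2 / 4 * hw

theorem mem_simplestQuarticField (hw : w ^ 2 = (n : ℂ) ^ 2 + 16)
    (hα : α ^ 2 = ((n + w) / 4) ^ 2 + 1) :
    w ∈ simplestQuarticField n ∧ α ∈ simplestQuarticField n := by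
  set K := simplestQuarticField n
  have hroot : ∀ x : ℂ, x ^ 4 - n * x ^ 3 - 6 * x ^ 2 + n * x + 1 = 0 → x ∈ K := fun x hx =>
    IntermediateField.subset_adjoin _ _ (mem_rootSet_simplestQuartic.2 hx)
  have h1 : (n + w) / 4 + α ∈ K := hroot _ (by
    rw [simplestQuartic_factor hw]
    linear_combination (((n + w) / 4 + α) ^ 2 - 2 * ((n - w) / 4) * ((n + w) / 4 + α) - 1) * hα)
  have h2 : (n + w) / 4 - α ∈ K := hroot _ (by
    rw [simplestQuartic_factor hw]
    linear_combination (((n + w) / 4 - α) ^ 2 - 2 * ((n - w) / 4) * ((n + w) / 4 - α) - 1) * hα)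
  have hn : (n : ℂ) ∈ K := by simp
  have hnat : ∀ k : ℕ, (k : ℂ) ∈ K := fun k => by simp
  constructor
  · have := sub_mem (mul_mem (hnat 2) (add_mem h1 h2)) hn
    convert this using 1
    push_cast
    ring
  · have := div_mem (sub_mem h1 h2) (hnat 2)
    convert this using 1
    push_cast
    ring

theorem exists_of_mem_simplestQuarticField (hw : w ^ 2 = (n : ℂ) ^ 2 + 16)
    (hα : α ^ 2 = ((n + w) / 4) ^ 2 + 1) {x : ℂ} (hx : x ∈ simplestQuarticField n) :
    ∃ a ∈ IntermediateField.adjoin ℚ {w}, ∃ b ∈ IntermediateField.adjoin ℚ {w},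
      x = a + b * α := by
  set k := IntermediateField.adjoin ℚ {w}
  have hn : (n : ℂ) ∈ k := by simp
  have hnat : ∀ j : ℕ, (j : ℂ) ∈ k := fun j => by simp
  have hwk : w ∈ k := IntermediateField.mem_adjoin_simple_self ℚ w
  have he : (n + w) / 4 ∈ k := div_mem (add_mem hn hwk) (by simp)
  have he' : (n - w) / 4 ∈ k := div_mem (sub_mem hn hwk) (by simp)
  have hN : (n : ℂ) ^ 2 + 16 ≠ 0 := by
    have : n ^ 2 + 16 ≠ 0 := by positivity
    exact_mod_cast this
  have hw0 : w ≠ 0 := by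
    rintro rfl
    apply hN
    rw [← hw]
    ring
  have hαw : α ^ 2 = (n + w) / 4 * (w / 2) := by
    rw [hα]
    linear_combination -1 / 16 * hw
  have hee : (n + w) / 4 * ((n - w) / 4) = -1 := by
    linear_combination -1 / 16 * hw
  have hα0 : α ≠ 0 := by
    rintro rfl
    have : (n + w) / 4 = 0 := by
      have := hαw.symm
      simpa [hw0] using this
    rw [this] at hee
    norm_num at hee
  have hα2 : α ^ 2 ∈ k := by
    rw [hα]
    exact add_mem (pow_mem he 2) (one_mem _)
  refine mem_adjoin_quadratic k hα2 ?_ hx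
  intro x hx
  rw [mem_rootSet_simplestQuartic, simplestQuartic_factor hw, mul_eq_zero] at hx
  rcases hx with hx | hx
  · have : (x - (n + w) / 4 - α) * (x - (n + w) / 4 + α) = 0 := by
      linear_combination hx - hα
    rcases mul_eq_zero.1 this with h | h
    · exact ⟨_, he, 1, one_mem _, by linear_combination h⟩
    · exact ⟨_, he, -1, neg_mem (one_mem _), by linear_combination h⟩
  -- The other radicand is `ε̄² + 1 = -ε̄w/2`; its product with `α² = εw/2` is `(w/2)²`, so its
  -- square root is `(w/2)/α`, an element of `kα`.
  · have hβ : (w / 2 * (α ^ 2)⁻¹ * α) ^ 2 = ((n - w) / 4) ^ 2 + 1 := by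
      have : (w / 2 * (α ^ 2)⁻¹ * α) ^ 2 = (w / 2) ^ 2 / α ^ 2 := by field_simp
      rw [this, div_eq_iff (pow_ne_zero 2 hα0), hαw]
      linear_combination (-(n - w) / 4 * (w / 2)) * hee
    have hb : w / 2 * (α ^ 2)⁻¹ ∈ k :=
      mul_mem (div_mem hwk (by simp)) (inv_mem hα2)
    have : (x - (n - w) / 4 - w / 2 * (α ^ 2)⁻¹ * α) *
        (x - (n - w) / 4 + w / 2 * (α ^ 2)⁻¹ * α) = 0 := by
      linear_combination hx - hβ
    rcases mul_eq_zero.1 this with h | h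
    · exact ⟨_, he', _, hb, by linear_combination h⟩
    · exact ⟨_, he', _, neg_mem hb, by linear_combination h⟩

/-- The norm of the left side is `r²(n²+16)/4`, not a rational square, whereas the norm of `x²` is
the square of the norm of `x`. -/
theorem not_sq_mem_adjoin (hw : w ^ 2 = (n : ℂ) ^ 2 + 16) (hN : ¬ IsSquare ((n : ℚ) ^ 2 + 16))
    {r : ℚ} (hr : r ≠ 0) {x : ℂ} (hx : x ∈ IntermediateField.adjoin ℚ {w}) :
    r * (((n + w) / 4) ^ 2 + 1) ≠ x ^ 2 := by
  intro h
  have hw' : w ^ 2 = (((n : ℚ) ^ 2 + 16 : ℚ) : ℂ) := by rw [hw]; push_cast; ring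
  obtain ⟨p, q, rfl⟩ := (mem_adjoin_simple_quadratic hw').1 hx
  have h1 := rat_eq_zero_of_add_mul_eq_zero (x := p ^ 2 + q ^ 2 * (n ^ 2 + 16)
    - r * (n ^ 2 + 16) / 8) (y := 2 * p * q - r * n / 8) hN hw' (by
      push_cast
      linear_combination -h + (r / 16 - q ^ 2) * hw)
  apply hN
  refine ⟨2 * (p ^ 2 - q ^ 2 * (n ^ 2 + 16)) / r, ?_⟩
  field_simp
  linear_combination 4 * (n ^ 2 + 16) * (2 * p * q + r * n / 8) * h1.2
    - 4 * (p ^ 2 + q ^ 2 * (n ^ 2 + 16) + r * (n ^ 2 + 16) / 8) * h1.1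

end

/-- An element of `k(α)` whose square lies in `k` is in `k` or in `kα`. Applied to `w'` it leaves
only `k`; applied to `β`, the generator attached to `m`, it leaves only `kα`. -/
theorem exists_of_simplestQuarticField_eq {m n : ℤ} {w w' : ℂ} (hw : w ^ 2 = (n : ℂ) ^ 2 + 16)
    (hw' : w' ^ 2 = (m : ℂ) ^ 2 + 16) (hN : ¬ IsSquare ((n : ℚ) ^ 2 + 16))
    (h : simplestQuarticField m = simplestQuarticField n) :
    ∃ c : ℚ, c ≠ 0 ∧ w' = c * w ∧ ∃ p q : ℚ,
      ((m + w') / 4) ^ 2 + 1 = (p + q * w) ^ 2 * (((n + w) / 4) ^ 2 + 1) := by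
  have hwq : w ^ 2 = (((n : ℚ) ^ 2 + 16 : ℚ) : ℂ) := by rw [hw]; push_cast; ring
  have hwq' : w' ^ 2 = (((m : ℚ) ^ 2 + 16 : ℚ) : ℂ) := by rw [hw']; push_cast; ring
  have hM0 : (m : ℚ) ^ 2 + 16 ≠ 0 := by positivity
  obtain ⟨α, hα⟩ := IsAlgClosed.exists_pow_nat_eq (((n + w) / 4) ^ 2 + 1) (n := 2) (by norm_num)
  obtain ⟨β, hβ⟩ := IsAlgClosed.exists_pow_nat_eq (((m + w') / 4) ^ 2 + 1) (n := 2) (by norm_num)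
  obtain ⟨hwK, hαK⟩ := mem_simplestQuarticField hw hα
  obtain ⟨hwK', hβK⟩ := mem_simplestQuarticField hw' hβ
  set k := IntermediateField.adjoin ℚ {w} with hk
  have hrat : ∀ r : ℚ, (r : ℂ) ∈ k := fun r => by simp
  have hwk : w ∈ k := IntermediateField.mem_adjoin_simple_self ℚ w
  have hαk : α ∉ k := fun hα' =>
    not_sq_mem_adjoin hw hN one_ne_zero hα' (by rw [← hα]; simp)
  have hα2 : α ^ 2 ∈ k := by
    rw [hα]
    refine add_mem (pow_mem (div_mem (add_mem ?_ hwk) ?_) 2) (one_mem _)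
    · simp
    · simp
  have split : ∀ x ∈ simplestQuarticField n, x ^ 2 ∈ k → x ∈ k ∨ ∃ b ∈ k, x = b * α := by
    intro x hx hx2
    obtain ⟨a, ha, b, hb, rfl⟩ := exists_of_mem_simplestQuarticField hw hα hx
    by_cases ha0 : a = 0
    · exact Or.inr ⟨b, hb, by rw [ha0, zero_add]⟩
    by_cases hb0 : b = 0
    · exact Or.inl (by simpa [hb0] using ha)
    exfalso
    apply hαk
    have : α = ((a + b * α) ^ 2 - a ^ 2 - b ^ 2 * α ^ 2) / (a * b + a * b) := by
      have : a * b + a * b ≠ 0 := by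
        rw [← two_mul]
        simp [ha0, hb0]
      field_simp
      ring
    rw [this]
    exact div_mem (sub_mem (sub_mem hx2 (pow_mem ha 2)) (mul_mem (pow_mem hb 2) hα2))
      (add_mem (mul_mem ha hb) (mul_mem ha hb))
  have hwk'' : w' ∈ k := by
    rcases split w' (h ▸ hwK') (by rw [hwq']; exact hrat _) with h1 | ⟨b, hb, h1⟩
    · exact h1
    · exfalso
      -- If `w' = bα`, then `(m²+16)α² = (bα²)²` would be a square in `k`.
      have hδ : b * α ^ 2 ∈ k := mul_mem hb hα2
      refine not_sq_mem_adjoin hw hN hM0 hδ ?_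
      rw [← hwq', h1, ← hα]
      ring
  obtain ⟨p, q, hpq⟩ := (mem_adjoin_simple_quadratic hwq).1 hwk''
  -- With `w'` rational, `K_m` would be `ℚ + ℚβ`; as it contains the irrational `w`, `β` and hence
  -- `α` would lie in `k`.
  have hNM : ¬ IsSquare ((m : ℚ) ^ 2 + 16) := by
    rintro ⟨c, hc⟩
    have hc' : ∃ c : ℚ, w' = c := by
      have : (w' - c) * (w' + c) = 0 := by
        have : ((c * c : ℚ) : ℂ) = w' ^ 2 := by rw [← hc, hwq']
        push_cast at this
        linear_combination -this
      rcases mul_eq_zero.1 this with h1 | h1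
      · exact ⟨c, by linear_combination h1⟩
      · exact ⟨-c, by push_cast; linear_combination h1⟩
    obtain ⟨c, rfl⟩ := hc'
    have hbot : ∀ x ∈ IntermediateField.adjoin ℚ {(c : ℂ)}, ∃ r : ℚ, x = r := by
      intro x hx
      obtain ⟨p, q, rfl⟩ := (mem_adjoin_simple_quadratic hwq').1 hx
      exact ⟨p + q * c, by push_cast; ring⟩
    have hform : ∀ x ∈ simplestQuarticField n, ∃ p q : ℚ, x = p + q * β := by
      intro x hx
      obtain ⟨a, ha, b, hb, rfl⟩ := exists_of_mem_simplestQuarticField hw' hβ (h ▸ hx)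
      obtain ⟨p, rfl⟩ := hbot a ha
      obtain ⟨q, rfl⟩ := hbot b hb
      exact ⟨p, q, rfl⟩
    obtain ⟨p, q, h1⟩ := hform w hwK
    have hq : q ≠ 0 := by
      rintro rfl
      apply hN
      refine ⟨p, ?_⟩
      rw [h1] at hwq
      have : ((p * p : ℚ) : ℂ) = (((n : ℚ) ^ 2 + 16 : ℚ) : ℂ) := by
        rw [← hwq]; push_cast; ring
      exact_mod_cast this.symm
    have hβk : β ∈ k := by
      have hq' : (q : ℂ) ≠ 0 := by exact_mod_cast hq
      have : β = (w - p) / q := by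
        rw [h1]
        field_simp
        ring
      rw [this]
      exact div_mem (sub_mem hwk (hrat p)) (hrat q)
    obtain ⟨p', q', h2⟩ := hform α hαK
    apply hαk
    rw [h2]
    exact add_mem (hrat _) (mul_mem (hrat _) hβk)
  have hp : p = 0 := by
    rcases rat_mul_eq_zero_of_sq_eq hN hwq (x := (m : ℚ) ^ 2 + 16) (p := p) (q := q)
      (by rw [← hwq', hpq]) with h1 | h1
    · exact absurd ⟨p, by rw [h1]; ring⟩ hNM
    · have h2 := rat_eq_zero_of_add_mul_eq_zero
        (x := p ^ 2 + q ^ 2 * (n ^ 2 + 16) - (m ^ 2 + 16)) (y := 2 * p * q) hN hwq (by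
          push_cast
          push_cast at hwq hwq'
          rw [hpq] at hwq'
          linear_combination hwq' - q ^ 2 * hwq)
      have h3 := h2.1
      rw [h1] at h3
      have : p ^ 2 = 0 := by linarith
      simpa using this
  subst hp
  have hcw : w' = q * w := by rw [hpq]; simp
  have hq0 : q ≠ 0 := by
    rintro rfl
    apply hM0
    have : (((m : ℚ) ^ 2 + 16 : ℚ) : ℂ) = 0 := by rw [← hwq', hcw]; simp
    exact_mod_cast this
  refine ⟨q, hq0, hcw, ?_⟩
  have hwk' : w ∈ IntermediateField.adjoin ℚ {w'} := by
    refine (mem_adjoin_simple_quadratic hwq').2 ⟨0, q⁻¹, ?_⟩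
    have hq' : (q : ℂ) ≠ 0 := by exact_mod_cast hq0
    rw [hcw]
    push_cast
    field_simp
    ring
  have hkk : k ≤ IntermediateField.adjoin ℚ {w'} := by
    rw [hk, IntermediateField.adjoin_simple_le_iff]
    exact hwk'
  rcases split β (h ▸ hβK) (by
    rw [hβ]
    refine add_mem (pow_mem (div_mem (add_mem ?_ hwk'') ?_) 2) (one_mem _)
    · simp
    · simp) with h1 | ⟨b, hb, h1⟩
  · exact absurd (by rw [← hβ]; simp) (not_sq_mem_adjoin hw' hNM one_ne_zero (hkk h1))
  · obtain ⟨p, q, rfl⟩ := (mem_adjoin_simple_quadratic hwq).1 hb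
    exact ⟨p, q, by rw [← hβ, ← hα, h1]; ring⟩

/-! ### Units of norm `-1` as powers of the fundamental unit -/

open NumberField in
theorem exists_unit_of_norm_neg_one {k : IntermediateField ℚ ℝ} {x : ℝ} (hx : x ∈ k) {t : ℤ}
    (h : x ^ 2 - t * x - 1 = 0) : ∃ η : (𝓞 k)ˣ, (((η : 𝓞 k) : k) : ℝ) = x := by
  have hint : IsIntegral ℤ (⟨x, hx⟩ : k) := by
    refine ⟨Polynomial.X ^ 2 - Polynomial.C t * Polynomial.X - 1, by monicity!, ?_⟩
    apply Subtype.ext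
    have ht : Polynomial.eval₂ (Int.castRingHom k) ⟨x, hx⟩ (t : Polynomial ℤ) = t := by
      rw [← Polynomial.C_eq_intCast, Polynomial.eval₂_C]
      rfl
    simpa [ht] using h
  let z : 𝓞 k := ⟨⟨x, hx⟩, hint⟩
  have hz : z * (z - t) = 1 := by
    apply RingOfIntegers.ext
    apply Subtype.ext
    have hzx : ((z : k) : ℝ) = x := rfl
    simp only [map_mul, map_sub, map_intCast, map_one, MulMemClass.coe_mul,
      AddSubgroupClass.coe_sub, OneMemClass.coe_one, hzx]
    push_cast
    linear_combination h
  exact ⟨Units.mkOfMulEqOne _ _ hz, rfl⟩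

/-- A unit `x > 1` of norm `-1` is a natural power of the fundamental unit. -/
theorem exists_pow_of_isFundamentalUnit {k : IntermediateField ℚ ℝ} {ε : ℝ}
    (hε : IsFundamentalUnit k ε) {x : ℝ} (hx : x ∈ k) (hx1 : 1 < x) {t : ℤ}
    (h : x ^ 2 - t * x - 1 = 0) : ∃ j : ℕ, x = ε ^ j := by
  obtain ⟨hε1, w, rfl, hw⟩ := hε
  obtain ⟨η, rfl⟩ := exists_unit_of_norm_neg_one hx h
  set e : ℝ := (((w : NumberField.RingOfIntegers k) : k) : ℝ)
  have hpow : ∀ j : ℤ, ((((w ^ j : (NumberField.RingOfIntegers k)ˣ) :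
      NumberField.RingOfIntegers k) : k) : ℝ) = e ^ j := by
    intro j
    let φ : (NumberField.RingOfIntegers k)ˣ →* ℝˣ :=
      Units.map ((algebraMap k ℝ).comp (algebraMap (NumberField.RingOfIntegers k) k)).toMonoidHom
    exact (congrArg (fun z : ℝˣ => (z : ℝ)) (map_zpow φ w j)).trans (Units.val_zpow_eq_zpow_val _ _)
  have hpos : ∀ j : ℤ, 0 < e ^ j := fun j => zpow_pos (by linarith) j
  obtain ⟨j, hj | hj⟩ := hw η
  · rw [hj, hpow] at hx1 ⊢
    have hj0 : 0 ≤ j := by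
      by_contra! hlt
      have := zpow_le_one_of_nonpos₀ hε1.le hlt.le
      linarith
    lift j to ℕ using hj0
    exact ⟨j, by simp⟩
  · exfalso
    have h2 := hpow j
    have h3 := hpos j
    rw [hj] at hx1
    simp only [Units.val_neg, map_neg, NegMemClass.coe_neg] at hx1
    rw [h2] at hx1
    linarith

/-! ### Congruences modulo 8 and the uniqueness argument -/

theorem not_isSquare_sq_add_sixteen {n : ℤ} (hn : n % 4 = 2) :
    ¬ IsSquare ((n : ℚ) ^ 2 + 16) := by
  intro h
  have h1 : IsSquare (n ^ 2 + 16) := Rat.isSquare_intCast_iff.1 (by push_cast; exact h)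
  obtain ⟨c, hc⟩ := h1
  obtain ⟨t, rfl⟩ : ∃ t, n = 4 * t + 2 := ⟨n / 4, by omega⟩
  rcases Int.even_or_odd' c with ⟨e, rfl | rfl⟩
  · have h2 : 4 * (t ^ 2 + t) + 5 = e * e := by linarith
    rcases Int.even_or_odd' e with ⟨f, rfl | rfl⟩
    · ring_nf at h2
      omega
    · have h3 : t * (t + 1) + 1 = f * (f + 1) := by linarith
      have h4 := Int.even_mul_succ_self t
      rw [Int.even_iff] at h4
      have h5 := Int.even_mul_succ_self f
      rw [Int.even_iff] at h5
      omega
  · ring_nf at hc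
    omega

/-- An odd `y` would give `4 ∣ d`. So `y` is even, and `(n/2)² + 4 = (y/2)²d` is `5` modulo `8`. -/
theorem emod_eight_eq_five {n d y : ℤ} (hn : n % 4 = 2) (h : n ^ 2 + 16 = y ^ 2 * d)
    (hd : Squarefree d) :
    d % 8 = 5 := by
  obtain ⟨t, rfl⟩ : ∃ t, n = 4 * t + 2 := ⟨n / 4, by omega⟩
  have sq8 : ∀ f : ℤ, (2 * f + 1) ^ 2 % 8 = 1 := by
    intro f
    have h5 := Int.even_mul_succ_self f
    rw [Int.even_iff] at h5
    have : (2 * f + 1) ^ 2 = 4 * (f * (f + 1)) + 1 := by ring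
    omega
  rcases Int.even_or_odd' y with ⟨e, rfl | rfl⟩
  · have h2 : (2 * t + 1) ^ 2 + 4 = e ^ 2 * d := by linarith
    have h3 := sq8 t
    rcases Int.even_or_odd' e with ⟨f, rfl | rfl⟩
    · have : (2 * f) ^ 2 * d = 4 * (f ^ 2 * d) := by ring
      omega
    · have h4 : ((2 * t + 1) ^ 2 + 4) % 8 = 5 := by omega
      rwa [h2, Int.mul_emod, sq8 f, one_mul, Int.emod_emod] at h4
  · exfalso
    have h1 : d % 4 = 0 := by
      have h5 := sq8 e
      obtain ⟨g, hg⟩ : ∃ g, (2 * e + 1) ^ 2 = 4 * g + 1 := ⟨(2 * e + 1) ^ 2 / 4, by omega⟩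
      rw [hg] at h
      have e1 : (4 * t + 2) ^ 2 + 16 = 4 * (4 * t ^ 2 + 4 * t + 5) := by ring
      have e2 : (4 * g + 1) * d = 4 * (g * d) + d := by ring
      omega
    have h2 : (2 : ℤ) * 2 ∣ d := by omega
    have := Int.isUnit_iff.1 (hd 2 h2)
    omega

/-- For odd `m` the left side is `1` modulo `8`, while `d * z ^ 2` is `5` or even. Evenness of `m`
makes the trace `m/2` of `η` an integer. -/
theorem even_of_sq_add_sixteen {m d z : ℤ} (hd : d % 8 = 5) (h : m ^ 2 + 16 = d * z ^ 2) :
    Even m := by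
  have sq8 : ∀ f : ℤ, (2 * f + 1) ^ 2 % 8 = 1 := by
    intro f
    have h5 := Int.even_mul_succ_self f
    rw [Int.even_iff] at h5
    have : (2 * f + 1) ^ 2 = 4 * (f * (f + 1)) + 1 := by ring
    omega
  by_contra hm
  obtain ⟨f, rfl⟩ := Int.not_even_iff_odd.1 hm
  have h1 := sq8 f
  rcases Int.even_or_odd' z with ⟨e, rfl | rfl⟩
  · have : d * (2 * e) ^ 2 = 4 * (d * e ^ 2) := by ring
    omega
  · have h2 : (d * (2 * e + 1) ^ 2) % 8 = 5 := by
      rw [Int.mul_emod, sq8 e, hd]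
      norm_num
    omega

theorem eq_of_simplestQuarticField_eq {n : ℤ} (hn0 : 0 < n) (hn : n % 4 = 2) {r p : ℕ}
    (hcrit : UniquenessCriterion n r p) {m : ℤ} (hm0 : 0 < m)
    (hmn : simplestQuarticField m = simplestQuarticField n) : m = n := by
  obtain ⟨d, y, ε, ε', u, v, hd, hnd, hε, hε', hfund, hu, hv, hr, hp, hp4, hpv, hsq⟩ := hcrit
  have hdZ : Squarefree (d : ℤ) := Int.squarefree_natCast.2 hd
  obtain ⟨P, rfl, hP⟩ : ∃ P, n = 2 * P ∧ Odd P := ⟨n / 2, by omega, Int.odd_iff.2 (by omega)⟩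
  set n := 2 * P with hnP
  have hndR : (n : ℝ) ^ 2 + 16 = (y : ℝ) ^ 2 * d := by exact_mod_cast hnd
  have hNpos : (0 : ℝ) < (n : ℝ) ^ 2 + 16 := by positivity
  set w : ℝ := Real.sqrt ((n : ℝ) ^ 2 + 16) with hw
  have hw2 : w ^ 2 = (n : ℝ) ^ 2 + 16 := Real.sq_sqrt hNpos.le
  have hwpos : 0 < w := Real.sqrt_pos.2 hNpos
  have hwyd : w = y * Real.sqrt d := by
    rw [hw, hndR, Real.sqrt_mul (by positivity), Real.sqrt_sq (by positivity)]
  rw [← hwyd] at hε hε'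
  have hnR : (n : ℝ) = 2 * P := by rw [hnP]; push_cast; ring
  have hee : ε * ε' = -1 := by
    rw [hε, hε']
    linear_combination -1 / 16 * hw2
  have hsub : ε - ε' = w / 2 := by rw [hε, hε']; ring
  have hL : IsLucasPair P ε ε' u v :=
    ⟨by rw [hε, hε', hnR]; ring, hee, by rw [hsub]; positivity, hu, hv⟩
  have hN := not_isSquare_sq_add_sixteen hn
  have hw2q : w ^ 2 = (((n : ℚ) ^ 2 + 16 : ℚ) : ℝ) := by rw [hw2]; push_cast; ring
  set w' : ℝ := Real.sqrt ((m : ℝ) ^ 2 + 16) with hw'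
  have hMpos : (0 : ℝ) < (m : ℝ) ^ 2 + 16 := by positivity
  have hw2' : w' ^ 2 = (m : ℝ) ^ 2 + 16 := Real.sq_sqrt hMpos.le
  have hwpos' : 0 < w' := Real.sqrt_pos.2 hMpos
  obtain ⟨c, hc0, hc, a, b, hab⟩ := exists_of_simplestQuarticField_eq (w := w) (w' := w')
    (by exact_mod_cast hw2) (by exact_mod_cast hw2') hN hmn
  have hcR : w' = c * w := by exact_mod_cast hc
  have habR : ((m + w') / 4) ^ 2 + 1 = (a + b * w) ^ 2 * (((n + w) / 4) ^ 2 + 1) := by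
    exact_mod_cast hab
  have hmc : (m : ℚ) ^ 2 + 16 = c ^ 2 * (n ^ 2 + 16) := by
    have : (m : ℝ) ^ 2 + 16 = c ^ 2 * (n ^ 2 + 16) := by rw [← hw2', hcR, ← hw2]; ring
    exact_mod_cast this
  obtain ⟨t, ht⟩ : Even m := by
    have h1 : IsSquare ((d : ℤ) * (m ^ 2 + 16)) := by
      refine Rat.isSquare_intCast_iff.1 ⟨c * y * d, ?_⟩
      have : (n : ℚ) ^ 2 + 16 = (y : ℚ) ^ 2 * d := by exact_mod_cast hnd
      push_cast
      rw [hmc, this]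
      ring
    obtain ⟨e, he⟩ := h1
    obtain ⟨f, rfl⟩ : (d : ℤ) ∣ e :=
      (hdZ.dvd_pow_iff_dvd two_ne_zero).1 ⟨m ^ 2 + 16, by rw [he]; ring⟩
    refine even_of_sq_add_sixteen (emod_eight_eq_five hn hnd hdZ) (z := f) ?_
    apply mul_left_cancel₀ hdZ.ne_zero
    rw [he]
    ring
  have hmR : (m : ℝ) = 2 * t := by rw [ht]; push_cast; ring
  have hm0R : (0 : ℝ) < m := by exact_mod_cast hm0
  obtain ⟨j, hj⟩ := exists_pow_of_isFundamentalUnit hfund (x := (m + w') / 4) (t := t)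
    ((mem_adjoin_simple_quadratic hw2q).2 ⟨m / 4, c / 4, by rw [hcR]; push_cast; ring⟩)
    (by nlinarith) (by
      rw [hmR] at hw2' ⊢
      linear_combination hw2' / 16)
  have h2 := hL.two_mul_pow j
  rw [← hj, hcR, hsub] at h2
  have h3 := rat_eq_zero_of_add_mul_eq_zero (x := m / 2 - v j) (y := c / 2 - u j / 2) hN hw2q (by
    push_cast
    linear_combination h2)
  have hcu : c = u j := by linarith [h3.2]
  have hvm : v j = t := by
    have : (v j : ℚ) = t := by
      have hmQ : (m : ℚ) = 2 * t := by rw [ht]; push_cast; ring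
      linarith [h3.1]
    exact_mod_cast this
  have hcuR : (c : ℝ) = u j := by rw [hcu]; simp
  -- `η` has norm `-1`: an even `j` would give `(m/2)² = c²w²/4 + 4` instead of `- 4`.
  have hjodd : Odd j := by
    by_contra hjo
    have h4 := hL.v_sq j
    rw [(Nat.not_odd_iff_even.1 hjo).neg_one_pow, hvm, hsub, ← hcuR] at h4
    have h5 : (m : ℝ) ^ 2 + 16 = c ^ 2 * w ^ 2 := by rw [← hw2', hcR]; ring
    rw [hmR] at h5
    linarith
  by_cases hj1 : j = 1
  · rw [hj1, hL.v_one] at hvm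
    omega
  exfalso
  obtain ⟨i, hi⟩ := hjodd
  have hεpos : 0 < ε := by have := hfund.1; linarith
  have h4 : ε ^ (2 * i) * u j = (a + b * w) ^ 2 := by
    have e1 : ((m + w') / 4) ^ 2 + 1 = ε ^ j * (u j * w / 2) := by
      rw [← hj, ← hcuR, ← hcR]
      linear_combination -hw2' / 16
    have e2 : ((n + w) / 4) ^ 2 + 1 = ε * (w / 2) := by
      rw [hε]
      linear_combination -hw2 / 16
    rw [e1, e2, hi, pow_succ] at habR
    rw [hi]
    have : ε * (w / 2) ≠ 0 := by positivity
    apply mul_right_cancel₀ this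
    linear_combination habR
  -- `εε' = -1`, so multiplying by `ε'^(2i)` cancels `ε^(2i)` and exhibits `u j` as a square in `k`.
  have h5 : (u j : ℝ) = ((a + b * w) * ε' ^ i) ^ 2 := by
    rw [mul_pow, ← h4]
    have : (ε * ε') ^ (2 * i) = 1 := by rw [hee]; simp
    rw [mul_pow] at this
    linear_combination -(u j : ℝ) * this
  have h6 : (a + b * w) * ε' ^ i ∈ IntermediateField.adjoin ℚ {w} := by
    refine mul_mem ((mem_adjoin_simple_quadratic hw2q).2 ⟨a, b, rfl⟩) (pow_mem ?_ i)
    exact (mem_adjoin_simple_quadratic hw2q).2 ⟨n / 4, -1 / 4, by rw [hε']; push_cast; ring⟩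
  obtain ⟨a', b', hab'⟩ := (mem_adjoin_simple_quadratic hw2q).1 h6
  rw [hab'] at h5
  rcases rat_mul_eq_zero_of_sq_eq hN hw2q (x := u j) (by rw [← h5]; simp) with h7 | h7
  · exact hL.not_isSquare_u hP ⟨i, hi⟩ hj1 (Rat.isSquare_intCast_iff.1 ⟨a', by rw [h7]; ring⟩)
  · refine hL.not_isSquare_mul_u hdZ hr hpv hsq ⟨i, hi⟩
      (Rat.isSquare_intCast_iff.1 ⟨b' * y * d, ?_⟩)
    have : (n : ℚ) ^ 2 + 16 = (y : ℚ) ^ 2 * d := by exact_mod_cast hnd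
    push_cast
    rw [h7, this]
    ring

/-! ### Fundamentality of `(P + √d)/2` for squarefree `d = P² + 4` -/

theorem exists_int_of_sq_mul {d : ℕ} (hd : Squarefree d) {r : ℚ} {K : ℤ} (h : r ^ 2 * d = K) :
    ∃ b : ℤ, r = b := by
  have hdZ : Squarefree (d : ℤ) := Int.squarefree_natCast.2 hd
  have hd0 : (d : ℚ) ≠ 0 := by exact_mod_cast hd.ne_zero
  obtain ⟨e, he⟩ : IsSquare ((d : ℤ) * K) :=
    Rat.isSquare_intCast_iff.1 ⟨d * r, by push_cast; rw [← h]; ring⟩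
  obtain ⟨f, rfl⟩ : (d : ℤ) ∣ e := (hdZ.dvd_pow_iff_dvd two_ne_zero).1 ⟨K, by rw [he]; ring⟩
  have h1 : (r - f) * (r + f) = 0 := by
    have h2 : (d : ℚ) * K = d * f * (d * f) := by exact_mod_cast he
    have h3 : (d : ℚ) ^ 2 * ((r - f) * (r + f)) = 0 := by
      rw [← h] at h2
      linear_combination h2
    simpa [hd0] using h3
  rcases mul_eq_zero.1 h1 with h2 | h2
  · exact ⟨f, by linarith⟩
  · exact ⟨-f, by push_cast; linarith⟩

/-- Twice an integer of `ℚ(√d)`. -/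
theorem exists_of_isIntegral {d : ℕ} (hd : Squarefree d) (hsq : ¬ IsSquare (d : ℚ)) {s : ℝ}
    (hs : s ^ 2 = (d : ℚ)) {p q : ℚ} (h : IsIntegral ℤ ((p : ℝ) + q * s)) :
    ∃ a b N : ℤ, 2 * ((p : ℝ) + q * s) = a + b * s ∧ a ^ 2 - d * b ^ 2 = 4 * N := by
  have key : ∃ a N : ℤ, 2 * p = a ∧ p ^ 2 - q ^ 2 * d = N := by
    by_cases hq : q = 0
    · subst hq
      have h1 : IsIntegral ℤ p := by
        have : IsIntegral ℤ (algebraMap ℚ ℝ p) := by simpa using h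
        exact (isIntegral_algebraMap_iff (algebraMap ℚ ℝ).injective).1 this
      obtain ⟨a, rfl⟩ := IsIntegrallyClosed.isIntegral_iff.1 h1
      exact ⟨2 * a, a ^ 2, by simp, by simp⟩
    · set x : ℝ := (p : ℝ) + q * s
      -- For `q ≠ 0` this is the minimal polynomial of `x`; as `x` is integral and `ℤ` integrally
      -- closed, its coefficients, the trace and norm, are integers.
      let g : Polynomial ℚ := Polynomial.X ^ 2 + (Polynomial.C (-(2 * p)) * Polynomial.X +
        Polynomial.C (p ^ 2 - q ^ 2 * d))
      have hg : g.Monic := by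
        apply Polynomial.monic_X_pow_add
        compute_degree!
      have hgd : g.natDegree = 2 := by
        simp only [g]
        compute_degree!
      have hgx : Polynomial.aeval x g = 0 := by
        push_cast at hs
        simp [g, x]
        linear_combination q ^ 2 * hs
      have hxQ : IsIntegral ℚ x := h.tower_top
      have hmin : minpoly ℚ x = g := by
        refine (Polynomial.eq_of_monic_of_dvd_of_natDegree_le (minpoly.monic hxQ) hg
          (minpoly.dvd ℚ x hgx) ?_).symm
        rw [hgd, minpoly.two_le_natDegree_iff hxQ]
        rintro ⟨r, hr⟩
        apply hq
        exact (rat_eq_zero_of_add_mul_eq_zero (x := p - r) hsq hs (by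
          have hr' : (r : ℝ) = x := by simpa using hr
          push_cast
          rw [hr']
          ring)).2
      rw [minpoly.isIntegrallyClosed_eq_field_fractions' ℚ h] at hmin
      have h0 := congrArg (fun f => Polynomial.coeff f 0) hmin
      have h1 := congrArg (fun f => Polynomial.coeff f 1) hmin
      simp only [Polynomial.coeff_map, eq_intCast, g, Polynomial.coeff_add, Polynomial.coeff_X_pow,
        Polynomial.coeff_C_mul, Polynomial.coeff_X, Polynomial.coeff_C] at h0 h1
      norm_num at h0 h1
      exact ⟨-(minpoly ℤ x).coeff 1, (minpoly ℤ x).coeff 0, by push_cast; linarith,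
        by rw [h0]⟩
  obtain ⟨a, N, ha, hN⟩ := key
  obtain ⟨b, hb⟩ := exists_int_of_sq_mul hd (r := 2 * q) (K := a ^ 2 - 4 * N) (by
    push_cast
    rw [← ha, ← hN]
    ring)
  refine ⟨a, b, N, ?_, ?_⟩
  · have ha' : (2 * p : ℝ) = a := by exact_mod_cast ha
    have hb' : (2 * q : ℝ) = b := by exact_mod_cast hb
    rw [← ha', ← hb']
    ring
  · have : (a : ℚ) ^ 2 - d * b ^ 2 = 4 * N := by
      rw [← ha, ← hb, ← hN]
      ring
    exact_mod_cast this

section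

variable {P d : ℕ} {s : ℝ}

/-- A unit strictly between `1` and `(P+s)/2` has conjugate of absolute value below `1`, so `a, b ≥
1`. Size forces `b = 1` and `a < P`, but `a² = P² + 4 ± 4 ≥ P²`. -/
theorem eq_one_of_lt_unit (hP : 0 < P) (hdP : d = P ^ 2 + 4) (hs : s ^ 2 = (d : ℝ))
    (hs0 : 0 < s) {a b N : ℤ} (hN : N = 1 ∨ N = -1) (hab : a ^ 2 - d * b ^ 2 = 4 * N)
    (h1 : 1 ≤ (a + b * s) / 2) (h2 : (a + b * s) / 2 < (P + s) / 2) : (a + b * s) / 2 = 1 := by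
  by_contra hne
  have hgt : 2 < a + b * s := by
    rcases h1.lt_or_eq with h | h
    · linarith
    · exact absurd h.symm hne
  have hdR : (d : ℝ) = P ^ 2 + 4 := by exact_mod_cast hdP
  have hPs : (P : ℝ) < s := by
    have : (0 : ℝ) ≤ P := by positivity
    nlinarith
  have hprod : (a + b * s) * (a - b * s) = 4 * N := by
    have : (a : ℝ) ^ 2 - d * b ^ 2 = 4 * N := by exact_mod_cast hab
    rw [← this, ← hs]
    ring
  have hbd : -2 < a - b * s ∧ a - b * s < 2 := by
    have hN' : (N : ℝ) = 1 ∨ (N : ℝ) = -1 := by exact_mod_cast hN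
    constructor
    · rcases hN' with h | h <;> rw [h] at hprod <;> nlinarith
    · rcases hN' with h | h <;> rw [h] at hprod <;> nlinarith
  have ha : 1 ≤ a := by
    have : (0 : ℝ) < a := by linarith
    exact_mod_cast this
  have hb : 1 ≤ b := by
    have : 0 < (b : ℝ) * s := by linarith
    have : (0 : ℝ) < b := pos_of_mul_pos_left this hs0.le
    exact_mod_cast this
  have haR : (1 : ℝ) ≤ a := by exact_mod_cast ha
  have hb1 : b = 1 := by
    by_contra hb1
    have : 2 ≤ b := by omega
    have hbR : (2 : ℝ) ≤ b := by exact_mod_cast this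
    nlinarith
  subst hb1
  have haP : a < P := by
    have : (a : ℝ) < P := by push_cast at h2; linarith
    exact_mod_cast this
  have hdZ : (d : ℤ) = P ^ 2 + 4 := by exact_mod_cast hdP
  rw [hdZ] at hab
  rcases hN with rfl | rfl <;> nlinarith

open NumberField in
/-- For squarefree `d = P² + 4`, the unit `(P + √d) / 2` is fundamental. -/
theorem isFundamentalUnit_of_sq_add_four (hP : 0 < P) (hdP : d = P ^ 2 + 4) (hd : Squarefree d) :
    IsFundamentalUnit (quadraticField (2 * P : ℕ)) ((P + Real.sqrt d) / 2) := by
  set s := Real.sqrt d with hsdef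
  have hs : s ^ 2 = (d : ℝ) := Real.sq_sqrt (by positivity)
  have hs0 : 0 < s := Real.sqrt_pos.2 (by exact_mod_cast (by omega : 0 < d))
  have hsq : ¬ IsSquare (d : ℚ) := by
    rw [Rat.isSquare_natCast_iff]
    rintro ⟨c, hc⟩
    have := Nat.isUnit_iff.1 (hd c ⟨1, by rw [hc, mul_one]⟩)
    subst this
    omega
  have hdR : (d : ℝ) = P ^ 2 + 4 := by exact_mod_cast hdP
  have hPR : (1 : ℝ) ≤ P := by exact_mod_cast hP
  have hsQ : s ^ 2 = ((d : ℚ) : ℝ) := by rw [hs]; simp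
  have hk : quadraticField (2 * P : ℕ) = IntermediateField.adjoin ℚ {2 * s} := by
    have : Real.sqrt ((((2 * P : ℕ) : ℤ) : ℝ) ^ 2 + 16) = 2 * s := by
      rw [show (((2 * P : ℕ) : ℤ) : ℝ) ^ 2 + 16 = (2 * s) ^ 2 by
        rw [mul_pow, hs, hdR]; push_cast; ring]
      exact Real.sqrt_sq (by positivity)
    rw [← this]
    rfl
  have h2sQ : (2 * s) ^ 2 = ((4 * d : ℚ) : ℝ) := by rw [mul_pow, hs]; push_cast; ring
  have hε1 : 1 < (P + s) / 2 := by nlinarith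
  refine ⟨hε1, ?_⟩
  obtain ⟨w, hw⟩ := exists_unit_of_norm_neg_one (k := quadraticField (2 * P : ℕ))
    (x := (P + s) / 2) (t := P)
    (by
      rw [hk]
      exact (mem_adjoin_simple_quadratic h2sQ).2 ⟨P / 2, 1 / 4, by push_cast; ring⟩)
    (by
      push_cast
      linear_combination hs / 4 + hdR / 4)
  refine ⟨w, hw, fun η => ?_⟩
  let φ : (𝓞 (quadraticField (2 * P : ℕ)))ˣ →* ℝ :=
    ((algebraMap (quadraticField (2 * P : ℕ)) ℝ).comp
      (algebraMap (𝓞 (quadraticField (2 * P : ℕ))) (quadraticField (2 * P : ℕ)))).toMonoidHom.comp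
      (Units.coeHom _)
  have hφw : φ w = (P + s) / 2 := hw
  have hφinj : Function.Injective φ := by
    intro x y hxy
    exact Units.ext (RingOfIntegers.ext (Subtype.ext hxy))
  have hφneg : ∀ x, φ (-x) = -φ x := by
    intro x
    simp [φ]
  have hform : ∀ x, ∃ a b N : ℤ, 2 * φ x = a + b * s ∧ a ^ 2 - d * b ^ 2 = 4 * N := by
    intro x
    have hx : IsIntegral ℤ (φ x) :=
      map_isIntegral_int (algebraMap (quadraticField (2 * P : ℕ)) ℝ)
        (RingOfIntegers.isIntegral_coe (x : 𝓞 (quadraticField (2 * P : ℕ))))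
    have hmem : φ x ∈ quadraticField (2 * P : ℕ) := SetLike.coe_mem _
    have hmem' : φ x ∈ IntermediateField.adjoin ℚ {2 * s} := hk.le hmem
    obtain ⟨p, q, hpq⟩ := (mem_adjoin_simple_quadratic h2sQ).1 hmem'
    have hpq' : φ x = (p : ℝ) + (2 * q : ℚ) * s := by rw [hpq]; push_cast; ring
    rw [hpq'] at hx ⊢
    exact exists_of_isIntegral hd hsq hsQ hx
  have hone : ∀ x, 1 ≤ φ x → φ x < (P + s) / 2 → x = 1 := by
    intro x h1 h2
    apply hφinj
    obtain ⟨a, b, N, h3, h4⟩ := hform x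
    obtain ⟨a', b', N', h3', h4'⟩ := hform x⁻¹
    have h5 : φ x * φ x⁻¹ = 1 := by rw [← map_mul, mul_inv_cancel, map_one]
    have h6 := rat_eq_zero_of_add_mul_eq_zero (x := a * a' + d * (b * b') - 4)
      (y := a * b' + a' * b) hsq hsQ (by
        push_cast
        have : (a + b * s) * (a' + b' * s) = 4 := by
          rw [← h3, ← h3']
          linear_combination 4 * h5
        linear_combination this - b * b' * hs)
    have h7 : (a : ℤ) * a' + d * (b * b') = 4 := by
      have : (a : ℚ) * a' + d * (b * b') = 4 := by linarith [h6.1]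
      exact_mod_cast this
    have h8 : (a : ℤ) * b' + a' * b = 0 := by exact_mod_cast h6.2
    -- Multiplicativity of the norm, `16NN' = (aa' + dbb')² - d(ab' + a'b)²`, shows that a unit has
    -- norm `±1`.
    have hNN : N * N' = 1 := by
      have : (4 * N) * (4 * N') = 16 := by
        rw [← h4, ← h4']
        linear_combination (a * a' + d * (b * b') + 4) * h7 - d * (a * b' + a' * b) * h8
      linarith
    have h9 : φ x = (a + b * s) / 2 := by linarith
    rw [h9] at h1 h2
    rw [h9, map_one]
    exact eq_one_of_lt_unit hP hdP hs hs0 (Int.isUnit_iff.1 (IsUnit.of_mul_eq_one _ hNN)) h4 h1 h2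
  have hpos : ∀ x, 0 < φ x → ∃ j : ℤ, x = w ^ j := by
    intro x hx
    obtain ⟨j, hj1, hj2⟩ := exists_mem_Ico_zpow hx hε1
    have hwz : φ (w ^ j) = ((P + s) / 2) ^ j := by
      rw [← hφw]
      exact (congrArg (fun z : ℝˣ => (z : ℝ)) (map_zpow φ.toHomUnits w j)).trans
        (Units.val_zpow_eq_zpow_val _ _)
    have hwpos : 0 < ((P + s) / 2) ^ j := zpow_pos (by linarith) j
    have hx' : φ (x * (w ^ j)⁻¹) * ((P + s) / 2) ^ j = φ x := by
      rw [← hwz, ← map_mul, inv_mul_cancel_right]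
    refine ⟨j, mul_inv_eq_one.1 (hone _ ?_ ?_)⟩
    · by_contra! hlt
      have := mul_lt_mul_of_pos_right hlt hwpos
      linarith
    · by_contra! hle
      have := mul_le_mul_of_nonneg_right hle hwpos.le
      rw [zpow_add_one₀ (by linarith)] at hj2
      linarith
  rcases lt_trichotomy (φ η) 0 with h | h | h
  · obtain ⟨j, hj⟩ := hpos (-η) (by rw [hφneg]; linarith)
    exact ⟨j, Or.inr (by rw [← hj, neg_neg])⟩
  · exfalso
    have h5 : φ η * φ η⁻¹ = 1 := by rw [← map_mul, mul_inv_cancel, map_one]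
    rw [h, zero_mul] at h5
    exact zero_ne_one h5
  · obtain ⟨j, hj⟩ := hpos η h
    exact ⟨j, Or.inl hj⟩

end

/-! ### Numerical verification for `n = 6, 10, 14` -/

/-- The Lucas sequence `U` of parameters `P`, `-1`. -/
def lucasU (P : ℤ) : ℕ → ℤ
  | 0 => 0
  | 1 => 1
  | j + 2 => P * lucasU P (j + 1) + lucasU P j

/-- The companion Lucas sequence `V` of parameters `P`, `-1`. -/
def lucasV (P : ℤ) : ℕ → ℤ
  | 0 => 2
  | 1 => P
  | j + 2 => P * lucasV P (j + 1) + lucasV P j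

theorem lucasU_mul_sub {P : ℤ} {a b : ℝ} (h : a + b = P) (hm : a * b = -1) (j : ℕ) :
    (lucasU P j : ℝ) * (a - b) = a ^ j - b ^ j := by
  induction j using Nat.twoStepInduction with
  | zero => simp [lucasU]
  | one => simp [lucasU]
  | more j h0 h1 =>
    rw [lucasU]
    push_cast
    rw [add_mul, mul_assoc, h0, h1, ← h]
    linear_combination (a ^ j - b ^ j) * hm

theorem lucasV_eq {P : ℤ} {a b : ℝ} (h : a + b = P) (hm : a * b = -1) (j : ℕ) :
    (lucasV P j : ℝ) = a ^ j + b ^ j := by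
  induction j using Nat.twoStepInduction with
  | zero => norm_num [lucasV]
  | one => simp [lucasV, h]
  | more j h0 h1 =>
    rw [lucasV]
    push_cast
    rw [h0, h1, ← h]
    linear_combination (a ^ j + b ^ j) * hm

/-- When `P² + 4` is squarefree, `y = 2` and the unit is fundamental automatically, so only finite
integer computations remain. -/
theorem uniquenessCriterion_of_sq_add_four {P d r p : ℕ} (hP : 0 < P) (hdP : d = P ^ 2 + 4)
    (hd : Squarefree d) (hr : Odd r) (hdr : (d : ℤ) ∣ lucasU P r)
    (hmin : ∀ j < r, Odd j → ¬ (d : ℤ) ∣ lucasU P j) (hp : p.Prime) (hp4 : p % 4 = 1)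
    (hpv : (p : ℤ) ∣ lucasV P r) (hsq : jacobiSym (d * lucasU P r % p) p = -1) :
    UniquenessCriterion (2 * P : ℕ) r p := by
  have hs : Real.sqrt d ^ 2 = (d : ℝ) := Real.sq_sqrt (by positivity)
  have hs0 : 0 < Real.sqrt d := Real.sqrt_pos.2 (by exact_mod_cast (by omega : 0 < d))
  have hdR : (d : ℝ) = P ^ 2 + 4 := by exact_mod_cast hdP
  have hε : (((2 * P : ℕ) : ℤ) + ((2 : ℕ) : ℝ) * Real.sqrt d) / 4 = (P + Real.sqrt d) / 2 := by
    push_cast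
    ring
  set ε : ℝ := (((2 * P : ℕ) : ℤ) + ((2 : ℕ) : ℝ) * Real.sqrt d) / 4 with hε0
  set ε' : ℝ := (((2 * P : ℕ) : ℤ) - ((2 : ℕ) : ℝ) * Real.sqrt d) / 4 with hε'0
  have hadd : ε + ε' = (P : ℤ) := by
    rw [hε0, hε'0]
    push_cast
    ring
  have hmul : ε * ε' = -1 := by
    rw [hε0, hε'0]
    push_cast
    linear_combination -1 / 4 * hs - hdR / 4
  have hsub : ε - ε' ≠ 0 := by
    have : ε - ε' = Real.sqrt d := by rw [hε0, hε'0]; push_cast; ring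
    rw [this]
    exact hs0.ne'
  refine ⟨d, 2, ε, ε', lucasU P, lucasV P, hd, ?_, rfl, rfl, ?_,
    fun j => eq_div_of_mul_eq hsub (lucasU_mul_sub hadd hmul j), lucasV_eq hadd hmul,
    ⟨⟨hr, hdr⟩, fun j hj => ?_⟩, hp, hp4, hpv, ?_⟩
  · rw [hdP]
    push_cast
    ring
  · rw [hε]
    exact isFundamentalUnit_of_sq_add_four hP hdP hd
  · by_contra! hlt
    exact hmin j hlt hj.1 hj.2
  · rw [← jacobiSym.mod_left] at hsq
    exact ZMod.nonsquare_of_jacobiSym_eq_neg_one hsq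

/-- First link of a Pratt certificate for the prime used with `n = 14`: each prime of the chain
divides the next one minus `1`, and `2`, `3`, `15` serve as primitive roots. -/
theorem prime_5922325997179 : Nat.Prime 5922325997179 := by
  refine lucas_primality _ 2 (by reduce_mod_char) fun q hq hqd => ?_
  rw [show 5922325997179 - 1 = 2 * 3 * 73 * 109121 * 123911 by norm_num] at hqd
  have h : q = 2 ∨ q = 3 ∨ q = 73 ∨ q = 109121 ∨ q = 123911 := by
    simpa only [hq.dvd_mul, Nat.prime_dvd_prime_iff_eq hq (by norm_num : Nat.Prime 2),
      Nat.prime_dvd_prime_iff_eq hq (by norm_num : Nat.Prime 3),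
      Nat.prime_dvd_prime_iff_eq hq (by norm_num : Nat.Prime 73),
      Nat.prime_dvd_prime_iff_eq hq (by norm_num : Nat.Prime 109121),
      Nat.prime_dvd_prime_iff_eq hq (by norm_num : Nat.Prime 123911), or_assoc] using hqd
  rcases h with rfl | rfl | rfl | rfl | rfl <;> norm_num only <;> reduce_mod_char <;> decide

theorem prime_8338635004028033 : Nat.Prime 8338635004028033 := by
  refine lucas_primality _ 3 (by reduce_mod_char) fun q hq hqd => ?_
  rw [show 8338635004028033 - 1 = 2 ^ 7 * 11 * 5922325997179 by norm_num] at hqd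
  have h : q = 2 ∨ q = 11 ∨ q = 5922325997179 := by
    rcases hq.dvd_mul.1 hqd with h | h
    · rcases hq.dvd_mul.1 h with h | h
      · exact Or.inl ((Nat.prime_dvd_prime_iff_eq hq Nat.prime_two).1 (hq.dvd_of_dvd_pow h))
      · exact Or.inr (Or.inl ((Nat.prime_dvd_prime_iff_eq hq (by norm_num)).1 h))
    · exact Or.inr (Or.inr ((Nat.prime_dvd_prime_iff_eq hq prime_5922325997179).1 h))
  rcases h with rfl | rfl | rfl <;> norm_num only <;> reduce_mod_char <;> decide

theorem prime_408359633417260832077 : Nat.Prime 408359633417260832077 := by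
  refine lucas_primality _ 15 (by reduce_mod_char) fun q hq hqd => ?_
  rw [show 408359633417260832077 - 1 = 2 * 2 * 3 * 7 * 11 * 53 * 8338635004028033 by
    norm_num] at hqd
  have h : q = 2 ∨ q = 2 ∨ q = 3 ∨ q = 7 ∨ q = 11 ∨ q = 53 ∨ q = 8338635004028033 := by
    simpa only [hq.dvd_mul, Nat.prime_dvd_prime_iff_eq hq (by norm_num : Nat.Prime 2),
      Nat.prime_dvd_prime_iff_eq hq (by norm_num : Nat.Prime 3),
      Nat.prime_dvd_prime_iff_eq hq (by norm_num : Nat.Prime 7),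
      Nat.prime_dvd_prime_iff_eq hq (by norm_num : Nat.Prime 11),
      Nat.prime_dvd_prime_iff_eq hq (by norm_num : Nat.Prime 53),
      Nat.prime_dvd_prime_iff_eq hq prime_8338635004028033, or_assoc] using hqd
  rcases h with rfl | rfl | rfl | rfl | rfl | rfl | rfl <;> norm_num only <;> reduce_mod_char <;>
    decide

theorem uniquenessCriterion_six : UniquenessCriterion 6 13 53 :=
  uniquenessCriterion_of_sq_add_four (P := 3) (d := 13) (by norm_num) (by norm_num)
    (Nat.Prime.prime (by norm_num)).squarefree (by decide) (by decide +kernel) (by decide +kernel)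
    (by norm_num) (by norm_num) (by decide +kernel) (by
      rw [show ((13 : ℕ) : ℤ) * lucasU (3 : ℕ) 13 % (53 : ℕ) = 23 by decide +kernel]
      norm_num)

theorem uniquenessCriterion_ten : UniquenessCriterion 10 29 64233493 :=
  uniquenessCriterion_of_sq_add_four (P := 5) (d := 29) (by norm_num) (by norm_num)
    (Nat.Prime.prime (by norm_num)).squarefree (by decide) (by decide +kernel) (by decide +kernel)
    (by norm_num) (by norm_num) (by decide +kernel) (by
      rw [show ((29 : ℕ) : ℤ) * lucasU (5 : ℕ) 29 % (64233493 : ℕ) = 52228452 by decide +kernel]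
      norm_num)

theorem uniquenessCriterion_fourteen : UniquenessCriterion 14 53 408359633417260832077 :=
  uniquenessCriterion_of_sq_add_four (P := 7) (d := 53) (by norm_num) (by norm_num)
    (Nat.Prime.prime (by norm_num)).squarefree (by decide) (by decide +kernel) (by decide +kernel)
    prime_408359633417260832077 (by norm_num) (by decide +kernel) (by
      rw [show ((53 : ℕ) : ℤ) * lucasU (7 : ℕ) 53 % (408359633417260832077 : ℕ) =
        234187394561096132928 by decide +kernel]
      norm_num)

theorem mainTheorem2 :
    (∀ n : ℤ, 0 < n → n % 4 = 2 →
      (∃ r₀ p : ℕ, UniquenessCriterion n r₀ p) →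
        ¬ ∃ m : ℤ, 0 < m ∧ m ≠ n ∧ simplestQuarticField m = simplestQuarticField n) ∧
    (UniquenessCriterion 6 13 53 ∧
      UniquenessCriterion 10 29 64233493 ∧
      UniquenessCriterion 14 53 408359633417260832077) ∧
    (∀ n : ℤ, n = 6 ∨ n = 10 ∨ n = 14 →
      ¬ ∃ m : ℤ, 0 < m ∧ m ≠ n ∧ simplestQuarticField m = simplestQuarticField n) := by
  have main : ∀ n : ℤ, 0 < n → n % 4 = 2 → (∃ r₀ p : ℕ, UniquenessCriterion n r₀ p) →
      ¬ ∃ m : ℤ, 0 < m ∧ m ≠ n ∧ simplestQuarticField m = simplestQuarticField n := by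
    rintro n hn0 hn ⟨r, p, hcrit⟩ ⟨m, hm0, hmn, h⟩
    exact hmn (eq_of_simplestQuarticField_eq hn0 hn hcrit hm0 h)
  refine ⟨main, ⟨uniquenessCriterion_six, uniquenessCriterion_ten,
    uniquenessCriterion_fourteen⟩, ?_⟩
  rintro n (rfl | rfl | rfl)
  · exact main 6 (by norm_num) (by norm_num) ⟨_, _, uniquenessCriterion_six⟩
  · exact main 10 (by norm_num) (by norm_num) ⟨_, _, uniquenessCriterion_ten⟩
  · exact main 14 (by norm_num) (by norm_num) ⟨_, _, uniquenessCriterion_fourteen⟩
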